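/- Let $K$ be an imaginary quadratic number field with ring of integers $\mathcal O_K$, let $\mathfrak p$ be a nonzero prime ideal of $\mathcal O_K$ with norm $N(\mathfrak p)$, let $K_{\mathfrak p}$ be the completion with ring of integers $\mathcal O_{K,\mathfrak p}$, normalised absolute value $\|\cdot\|_{\mathfrak p}=N(\mathfrak p)^{-v_{\mathfrak p}(\cdot)}$, and Haar measure with $\mathrm{vol}(\mathcal O_{K,\mathfrak p})=1$. **The surface.** Let $\widetilde{\mathcal S}$ be the $\mathcal O_K$-model of the minimal desingularisation $\widetilde S$ of the quartic del Pezzo surface $x_0x_1-x_2x_3=x_0x_3+x_1x_3+x_2x_4=0$ in $\mathbb P^4_K$ (of type $\mathbf A_3$, with singularity $Q=(0:0:0:0:1)$), given as the quotient $\widetilde{\mathcal S}=\mathcal Y/\mathbb G_m^6$ of its universal torsor. Here $\mathcal Y$ is the complement of $V(f_1,\dots,f_9)$ in $$\operatorname{Spec}\mathcal O_K[\eta_1,\dots,\eta_9]/(g),\qquad g=\eta_1\eta_4^2\eta_7+\eta_3\eta_6^2\eta_8+\eta_5\eta_9,$$ where $f_1,\dots,f_9$ are the products of the $\eta_j$ with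 $j$ outside $\{7,8,9\}$, $\{1,2\}$, $\{1,4\}$, $\{2,3\}$, $\{2,5\}$, $\{3,6\}$, $\{4,7\}$, $\{5,9\}$, $\{6,8\}$, respectively, and $\mathbb G_m^6$ acts through the degrees $\deg\eta_j=[E_j]$ in $\operatorname{Pic}(\widetilde S)=\bigoplus_{l=0}^5\mathbb Z\,l_l$: $$[E_1]=l_1-l_4,\ [E_2]=l_0-l_1-l_2-l_3,\ [E_3]=l_2-l_5,\ [E_4]=l_4,\ [E_5]=l_3,\ [E_6]=l_5,$$ $$[E_7]=l_0-l_1-l_4,\ [E_8]=l_0-l_2-l_5,\ [E_9]=l_0-l_3,$$ and $E_j\subset\widetilde S$ is the divisor $\eta_j=0$. **The boundaries.** Let $D_1=E_1+E_2+E_3$ (the divisor above $Q$) and $D_2=E_1+E_2+E_3+E_4$ (the divisor above the line $x_0=x_2=x_3=0$), let $\#D_i$ be the number of components of $D_i$, so $\#D_1=3$ and $\#D_2=4$, and let $\widetilde{\mathcal U}_i=\widetilde{\mathcal S}\setminus\overline{D_i}$. Thus $\widetilde{\mathcal U}_i(\mathcal O_{K,\mathfrak p})\subset\widetilde S(K_{\mathfrak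 p})$ consists of the classes of those $\eta\in\mathcal Y(\mathcal O_{K,\mathfrak p})$ for which $\eta_j$ is a unit for every component $E_j$ of $D_i$. **The measure.** Let $M_1=\{\eta_1\eta_2\eta_4^2\eta_5\eta_7,\ \eta_2\eta_3\eta_5\eta_6^2\eta_8,\ \eta_1\eta_2^2\eta_3\eta_4\eta_5^2\eta_6,\ \eta_4\eta_6\eta_7\eta_8\}$ and $M_2=\{\eta_1\eta_2\eta_4\eta_5\eta_7,\ \eta_1\eta_2^2\eta_3\eta_5^2\eta_6,\ \eta_6\eta_7\eta_8\}$. The elements of $M_i$ are sections of $\omega_{\widetilde S}(D_i)^\vee$ without common zero, and $\omega_{\widetilde S}(D_i)$ carries the $\mathfrak p$-adic metric dual to $\|s\|(\eta)=\|s(\eta)\|_{\mathfrak p}/\max_{m\in M_i}\|m(\eta)\|_{\mathfrak p}$. Here a section of a line bundle on $\widetilde S$ is identified with an element of its Cox ring (or, for a rational section, of the localisation) in the usual way: $1_{D_i}$ is $\prod_{E_j\subset D_i}\eta_j$, and a $2$-form is $h\,\Omega$, where $\Omega$ is the contraction of the Poincaré residue of $d\eta_1\wedge\dots\wedge d\eta_9/g$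 with the six vector fields that generate the torus action; in particular $dx\wedge dy$, for $x=\frac{\eta_4\eta_7}{\eta_2\eta_3\eta_5\eta_6}$ and $y=\frac{\eta_6\eta_8}{\eta_1\eta_2\eta_4\eta_5}$, corresponds up to sign to $1/(\eta_1^2\eta_2^3\eta_3^2\eta_4\eta_5^2\eta_6)$. Let $\tau_{(\widetilde S,D_i),\mathfrak p}$ be the associated $\mathfrak p$-adic Tamagawa measure of Chambert-Loir and Tschinkel: in local coordinates $(a,b)$ on $\widetilde S(K_{\mathfrak p})$ it is $\|(da\wedge db)\otimes 1_{D_i}\|^{-1}_{\omega_{\widetilde S}(D_i),\mathfrak p}\,da\,db$. **Proposition.** For $i=1,2$, $$\tau_{(\widetilde S,D_i),\mathfrak p}\bigl(\widetilde{\mathcal U}_i(\mathcal O_{K,\mathfrak p})\bigr)=1+\frac{6-\#D_i}{N(\mathfrak p)}.$$ -/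

import Mathlib

open MeasureTheory IsDedekindDomain IsDedekindDomain.HeightOneSpectrum NumberField

noncomputable section

namespace QuarticDelPezzo

/-! ### The universal torsor and the surface

Generators `η₁, …, η₉` of the Cox ring are indexed by `Fin 9`, so `η j` is `η_{j+1}`. -/

/-- The relation `η₁ η₄² η₇ + η₃ η₆² η₈ + η₅ η₉` of the Cox ring. -/
def torsorPoly : MvPolynomial (Fin 9) ℤ :=
  MvPolynomial.X 0 * MvPolynomial.X 3 ^ 2 * MvPolynomial.X 6
    + MvPolynomial.X 2 * MvPolynomial.X 5 ^ 2 * MvPolynomial.X 7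
    + MvPolynomial.X 4 * MvPolynomial.X 8

/-- The maximal sets of curves `E_j` that have a common point (the maximal sets of pairwise
adjacent vertices of the extended Dynkin diagram). -/
def maximalCliques : Fin 9 → Finset (Fin 9) :=
  ![{6, 7, 8}, {0, 1}, {0, 3}, {1, 2}, {1, 4}, {2, 5}, {3, 6}, {4, 8}, {5, 7}]

/-- The generators `f₁, …, f₉` of the irrelevant ideal: `f_k` is the product of the `η_j` over all
`j` outside the `k`-th maximal clique. -/
def irrelevantMonomial {R : Type*} [CommRing R] (k : Fin 9) (η : Fin 9 → R) : R :=
  ∏ j ∈ (maximalCliques k)ᶜ, η j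

/-- The `R`-points of the universal torsor `𝒴 = Spec (Cox ring) ∖ V(f₁, …, f₉)`. -/
def torsorPoints (R : Type*) [CommRing R] : Set (Fin 9 → R) :=
  {η | MvPolynomial.aeval η torsorPoly = 0 ∧
    Ideal.span (Set.range fun k => irrelevantMonomial k η) = ⊤}

/-- The degrees of `η₁, …, η₉` in `Pic = ℤ⁶`: the column `j` is the class `[E_{j+1}]` written in
the basis `l₀, …, l₅`. -/
def degreeMatrix : Matrix (Fin 6) (Fin 9) ℤ :=
  !![ 0,  1,  0, 0, 0, 0,  1,  1,  1;
      1, -1,  0, 0, 0, 0, -1,  0,  0;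
      0, -1,  1, 0, 0, 0,  0, -1,  0;
      0, -1,  0, 0, 1, 0,  0,  0, -1;
     -1,  0,  0, 1, 0, 0, -1,  0,  0;
      0,  0, -1, 0, 0, 1,  0, -1,  0]

/-- The action of the torus `𝔾ₘ⁶` through the degrees: `t` multiplies `η_j` by `t ^ deg η_j`. -/
def torusAct {R : Type*} [CommRing R] (t : Fin 6 → Rˣ) (η : Fin 9 → R) : Fin 9 → R :=
  fun j => ((∏ l, t l ^ degreeMatrix l j : Rˣ) : R) * η j

/-- Two points of the torsor are equivalent if they lie in the same torus orbit. -/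
instance torusSetoid (R : Type*) [CommRing R] : Setoid (torsorPoints R) where
  r η η' := ∃ t : Fin 6 → Rˣ, η'.1 = torusAct t η.1
  iseqv :=
    { refl := fun η => ⟨1, by funext j; simp [torusAct]⟩
      symm := fun {η η'} ⟨t, ht⟩ => ⟨t⁻¹, by
        funext j
        simp only [ht, torusAct, Pi.inv_apply, inv_zpow, Finset.prod_inv_distrib, ← mul_assoc,
          ← Units.val_mul, inv_mul_cancel, Units.val_one, one_mul]⟩
      trans := fun {η η' η''} ⟨t, ht⟩ ⟨u, hu⟩ => ⟨u * t, by
        funext j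
        simp only [hu, ht, torusAct, ← mul_assoc, ← Units.val_mul, ← Finset.prod_mul_distrib,
          Pi.mul_apply, mul_zpow]⟩ }

/-- The `F`-points of the weak del Pezzo surface `S̃ = 𝒴 / 𝔾ₘ⁶`, for a field `F`. As `𝒴 → S̃` is a
torsor under the split torus `𝔾ₘ⁶`, these are the torus orbits in `𝒴(F)`. -/
abbrev SurfacePoints (F : Type*) [Field F] : Type _ := Quotient (torusSetoid F)

/-- The boundary is the preimage of the singularity `Q` or of the line `L₂`. -/
inductive Boundary
  | singularity
  | line

/-- The components of the reduced divisor `D_i`: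
`D₁ = E₁ + E₂ + E₃` and `D₂ = E₁ + E₂ + E₃ + E₄`. -/
def boundaryComponents : Boundary → Finset (Fin 9)
  | .singularity => {0, 1, 2}
  | .line => {0, 1, 2, 3}

/-- For a local integral domain `R` with fraction field `F`, the subset `𝒰̃_i(R)` of `S̃(F)`.
An `R`-point of the model `𝒮̃ = 𝒴 / 𝔾ₘ⁶` lifts to `𝒴(R)`, and it lies in the complement `𝒰̃_i` of
the closure `V(∏ η_j)` of `D_i` if and only if `η_j` is a unit for every component `E_j`
of `D_i`. -/
def integralPoints (R : Type*) [CommRing R] (F : Type*) [Field F] [Algebra R F] (i : Boundary) :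
    Set (SurfacePoints F) :=
  {x | ∃ (η : torsorPoints R) (θ : torsorPoints F),
    (∀ j ∈ boundaryComponents i, IsUnit (η.1 j)) ∧
    (∀ j, θ.1 j = algebraMap R F (η.1 j)) ∧ x = Quotient.mk _ θ}

/-! ### The metric on the log-canonical bundle -/

section Metric

variable {F : Type*} [NormedField F]

/-- The generator `Ω` of `ω_S̃ ⊗ 𝒪(-K_S̃)`, as a 2-form on the torsor: the Poincaré residue of
`dη₁ ∧ ⋯ ∧ dη₉ / g` along `g = 0`, where `g` is `torsorPoly`, contracted with the six vector fields
`ξ_l = ∑ j, (deg η_j)_l • η_j • ∂/∂η_j` that generate the torus action.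
It is evaluated here at the point `η` and the tangent vectors `v`, `w`. The residue is computed by
eliminating `η_k`, which is possible wherever `∂g/∂η_k ≠ 0`, and does not depend on `k`. -/
def residueForm (k : Fin 9) (η v w : Fin 9 → F) : F :=
  let ξ : Fin 6 → Fin 9 → F := fun l j => (degreeMatrix l j : F) * η j
  Matrix.det (Matrix.of ![v, w, Pi.single k 1, ξ 0, ξ 1, ξ 2, ξ 3, ξ 4, ξ 5]) /
    MvPolynomial.aeval η (MvPolynomial.pderiv k torsorPoly)

/-- The maximum of the norms of the sections of `ω_S̃(D_i)^∨` that define its metric. -/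
def maxSectionNorm : Boundary → (Fin 9 → F) → ℝ
  | .singularity, η =>
      max (max ‖η 0 * η 1 * η 3 ^ 2 * η 4 * η 6‖ ‖η 1 * η 2 * η 4 * η 5 ^ 2 * η 7‖)
        (max ‖η 0 * η 1 ^ 2 * η 2 * η 3 * η 4 ^ 2 * η 5‖ ‖η 3 * η 5 * η 6 * η 7‖)
  | .line, η =>
      max (max ‖η 0 * η 1 * η 3 * η 4 * η 6‖ ‖η 0 * η 1 ^ 2 * η 2 * η 4 ^ 2 * η 5‖)
        ‖η 5 * η 6 * η 7‖

/-- The norm `‖ω ⊗ 1_{D_i}‖` in `ω_S̃(D_i)`, at the point with Cox coordinates `η`, of the 2-form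
`ω = h • Ω`: the section `1_{D_i}` is the product of the `η_j` over the components `E_j`
of `D_i`, and the metric is the one for which a section `s` of `ω_S̃(D_i)^∨` has norm
`‖s(η)‖ / maxSectionNorm i η`. -/
def logCanonicalNorm (i : Boundary) (η : Fin 9 → F) (h : F) : ℝ :=
  ‖h * ∏ j ∈ boundaryComponents i, η j‖ * maxSectionNorm i η

/-! ### Charts -/

/-- Cox coordinates of the inverses of nine charts of `S̃` with coordinates `(a, b)`. In the `k`-th
chart the six coordinates set to `1` have degrees that form a basis of `Pic`; this chart contains
the locus `f_k ≠ 0`, so the nine charts cover `S̃`. The first one is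
`(x, y) ↦ (1 : 1 : 1 : 1 : 1 : 1 : x : y : -x - y)`. -/
def chartPoly (k : Fin 9) : Fin 9 → MvPolynomial (Fin 2) ℤ :=
  let a : MvPolynomial (Fin 2) ℤ := MvPolynomial.X 0
  let b : MvPolynomial (Fin 2) ℤ := MvPolynomial.X 1
  (![ ![1, 1, 1, 1, 1, 1, a, b, -a - b],
      ![a, b, 1, 1, 1, 1, 1, 1, -a - 1],
      ![a, 1, 1, b, 1, 1, 1, 1, -(a * b ^ 2) - 1],
      ![1, a, b, 1, 1, 1, 1, 1, -b - 1],
      ![1, a, 1, 1, b, 1, -b - 1, 1, 1],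
      ![1, 1, a, 1, 1, b, 1, 1, -(a * b ^ 2) - 1],
      ![1, 1, 1, a, 1, 1, b, 1, -(a ^ 2 * b) - 1],
      ![1, 1, 1, 1, a, 1, -(a * b) - 1, 1, b],
      ![1, 1, 1, 1, 1, a, 1, b, -(a ^ 2 * b) - 1]] :
    Fin 9 → Fin 9 → MvPolynomial (Fin 2) ℤ) k

/-- The index of the Cox coordinate that is eliminated in the `k`-th chart. -/
def chartElim : Fin 9 → Fin 9 := ![8, 8, 8, 8, 6, 8, 8, 6, 8]

/-- The Cox coordinates of the point with coordinates `p` in the `k`-th chart. -/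
def chartCoord (k : Fin 9) (p : F × F) : Fin 9 → F :=
  fun j => MvPolynomial.aeval ![p.1, p.2] (chartPoly k j)

/-- The tangent vectors `∂/∂a` (`m = 0`) and `∂/∂b` (`m = 1`) in the `k`-th chart. -/
def chartTangent (k : Fin 9) (m : Fin 2) (p : F × F) : Fin 9 → F :=
  fun j => MvPolynomial.aeval ![p.1, p.2] (MvPolynomial.pderiv m (chartPoly k j))

/-- The norm `‖(da ∧ db) ⊗ 1_{D_i}‖` at the point `p` of the `k`-th chart; here
`da ∧ db = h • Ω` with `h = 1 / Ω(∂/∂a, ∂/∂b)`. -/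
def chartNorm (i : Boundary) (k : Fin 9) (p : F × F) : ℝ :=
  logCanonicalNorm i (chartCoord k p)
    (residueForm (chartElim k) (chartCoord k p) (chartTangent k 0 p) (chartTangent k 1 p))⁻¹

variable (F) in
/-- The domain of the `k`-th chart in the coordinate plane. -/
def chartDomain (k : Fin 9) : Set (F × F) := {p | chartCoord k p ∈ torsorPoints F}

/-- The inverse of the `k`-th chart. -/
def chartPoint (k : Fin 9) (p : chartDomain F k) : SurfacePoints F :=
  Quotient.mk _ ⟨chartCoord k p.1, p.2⟩

variable (F) in
/-- The part of the `k`-th chart that is not covered by the earlier ones. -/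
def newChartPart (k : Fin 9) : Set (chartDomain F k) :=
  {p | ∀ j < k, chartPoint k p ∉ Set.range (chartPoint (F := F) j)}

/-- The Tamagawa measure `τ_{(S̃,D_i)}` of Chambert-Loir and Tschinkel on `S̃(F)`, for a Haar measure
`μ` on the local field `F`: in local coordinates `(a, b)` it is
`‖(da ∧ db) ⊗ 1_{D_i}‖⁻¹ da db`. The measure is put together from the nine charts, each
restricted to the part of `S̃(F)` not covered by the earlier ones. -/
def tamagawaMeasure [MeasurableSpace F] (μ : Measure F) (i : Boundary) :
    Measure (SurfacePoints F) :=
  Measure.sum fun k : Fin 9 =>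
    ((((μ.prod μ).withDensity fun p => (ENNReal.ofReal (chartNorm i k p))⁻¹).comap
      (Subtype.val : chartDomain F k → F × F)).restrict (newChartPart F k)).map (chartPoint k)

end Metric

/-! ### The local field `K_𝔭` -/

section Local

variable {K : Type*} [Field K] [NumberField K] (v : HeightOneSpectrum (𝓞 K))

/-- The ring of integers of `K_𝔭` is compact. -/
theorem isCompact_adicIntegers :
    IsCompact (v.adicCompletionIntegers K : Set (v.adicCompletion K)) := by
  change IsCompact ((Valued.integer (v.adicCompletion K) : Subring _) : Set (v.adicCompletion K))
  rw [isCompact_iff_compactSpace]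
  change CompactSpace (Valued.integer (v.adicCompletion K))
  rw [Valued.integer.compactSpace_iff_completeSpace_and_isDiscreteValuationRing_and_finite_residueField]
  refine ⟨(Valued.isClosed_integer (v.adicCompletion K)).completeSpace_coe,
    inferInstanceAs (IsDiscreteValuationRing (v.adicCompletionIntegers K)), ?_⟩
  have : Finite (𝓞 K ⧸ v.asIdeal) := v.asIdeal.finiteQuotientOfFreeOfNeBot v.ne_bot
  let φ : 𝓞 K →+* Valued.integer (v.adicCompletion K) :=
    algebraMap (𝓞 K) (v.adicCompletionIntegers K)
  have hφ (r : 𝓞 K) : Valued.v (φ r : v.adicCompletion K) = v.valuation K (r : K) :=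
    valuedAdicCompletion_eq_valuation' v (r : K)
  let ψ := (IsLocalRing.residue (Valued.integer (v.adicCompletion K))).comp φ
  have hψ : ∀ r ∈ v.asIdeal, ψ r = 0 := fun r hr => by
    rw [RingHom.comp_apply, IsLocalRing.residue_eq_zero_iff, IsLocalRing.mem_maximalIdeal,
      mem_nonunits_iff, Valuation.Integer.not_isUnit_iff_valuation_lt_one, hφ]
    exact (v.valuation_lt_one_iff_mem r).2 hr
  refine Finite.of_surjective (Ideal.Quotient.lift v.asIdeal ψ hψ)
    (Ideal.Quotient.lift_surjective_of_surjective _ hψ fun y => ?_)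
  obtain ⟨x, rfl⟩ := IsLocalRing.residue_surjective y
  have hopen : IsOpen {z : v.adicCompletion K | Valued.v (z - x) < 1} := by
    have := (Valued.isOpen_ball (v.adicCompletion K) 1).preimage
      (continuous_sub_right (x : v.adicCompletion K))
    simpa [Set.preimage, Valuation.restrict_lt_one_iff] using this
  obtain ⟨k, hk⟩ := (denseRange_algebraMap (R := 𝓞 K) K v).exists_mem_open hopen ⟨x, by simp⟩
  have hk' : Valued.v ((k : v.adicCompletion K) - x) < 1 := hk
  have hk1 : v.valuation K k ≤ 1 := by
    rw [← valuedAdicCompletion_eq_valuation' v k]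
    have := Valued.v.map_add ((k : v.adicCompletion K) - x) x
    rw [sub_add_cancel] at this
    exact this.trans (max_le hk'.le x.2)
  obtain ⟨a, ha⟩ := exists_valuation_sub_lt_of_integer (K := K) v hk1 1
  refine ⟨a, ?_⟩
  change IsLocalRing.residue _ (φ a) = IsLocalRing.residue _ x
  rw [← sub_eq_zero, ← map_sub, IsLocalRing.residue_eq_zero_iff, IsLocalRing.mem_maximalIdeal,
    mem_nonunits_iff, Valuation.Integer.not_isUnit_iff_valuation_lt_one]
  have h1 : ((φ a - x : Valued.integer (v.adicCompletion K)) : v.adicCompletion K) =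
      (((a : K) - k : K) : v.adicCompletion K) + ((k : v.adicCompletion K) - x) := by
    rw [← add_sub_assoc, ← adicCompletion.coe_add, sub_add_cancel]
    rfl
  rw [h1]
  refine (Valued.v.map_add _ _).trans_lt (max_lt ?_ hk')
  rw [valuedAdicCompletion_eq_valuation' v]
  simpa using ha

/-- `K_𝔭` carries its Borel σ-algebra. -/
instance : MeasurableSpace (v.adicCompletion K) := borel _

instance : BorelSpace (v.adicCompletion K) := ⟨rfl⟩

/-- The Haar measure on `K_𝔭` for which the ring of integers has volume `1`. -/
def adicHaar : Measure (v.adicCompletion K) :=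
  Measure.addHaarMeasure
    ⟨⟨(v.adicCompletionIntegers K : Set (v.adicCompletion K)), isCompact_adicIntegers v⟩, by
      have h : IsOpen (v.adicCompletionIntegers K : Set (v.adicCompletion K)) :=
        Valued.isOpen_integer (v.adicCompletion K)
      exact ⟨0, by rw [h.interior_eq]; exact (v.adicCompletionIntegers K).zero_mem⟩⟩

end Local

end QuarticDelPezzo

end

/-!
The locus where `η₁, …, η₆` are nonzero is the plane with coordinates `(x, y)`, the first chart of
the atlas (the big chart). Its complement is null, so the Tamagawa measure is an integral over
this plane (`tamagawaMeasure_apply`). Here `1_{D_i} = 1` and `dx ∧ dy = ± Ω`, so the density is the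
inverse of `max (1, ‖x‖, ‖y‖, ‖xy‖)` for `D₁` and of `max (1, ‖x‖, ‖xy‖)` for `D₂`
(`chartNorm_singularity`, `chartNorm_line`).

The point `(x, y)` is integral if its torus orbit contains a point of `𝒴(𝒪)` with the boundary
coordinates units. Then `x = η₄η₇ / (η₂η₃η₅η₆)`, `y = η₆η₈ / (η₁η₂η₄η₅)` and
`x + y = -η₉ / (η₁η₂η₃η₄η₆)`, and since the nonunits among the `η_j` lie in one of the maximal
cliques, at most one of `η₄, η₅, η₆` is not a unit. This gives four disjoint pieces
(`mem_integralRegion_of_lift`, `exists_lift_of_mem_integralRegion`):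
* all three are units: `‖x‖, ‖y‖ ≤ 1`, with density `1`;
* `η₆` is not a unit: `‖x‖ > 1` and `‖xy‖ ≤ 1`, with density `‖x‖⁻¹`;
* `η₅` is not a unit: `‖x‖ > 1` and `‖x + y‖ ≤ 1`, with density `‖x‖⁻²`;
* `η₄` is not a unit, which is possible only for `D₁`: `‖y‖ > 1` and `‖xy‖ ≤ 1`, with
  density `‖y‖⁻¹`.

The first piece has measure `1`. Integrating over one coordinate first, each of the others reduces
to the integral of `‖x‖⁻²` over `‖x‖ > 1`, which is `N(𝔭)⁻¹` (`lintegral_inv_norm_sq`) because a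
ball of radius `N(𝔭)ⁿ` has volume `N(𝔭)ⁿ` (`adicHaar_norm_le_zpow`).

The comments number the Cox coordinates `η₁, …, η₉`; in the code, `η_{j+1}` is `η j`.
-/

namespace QuarticDelPezzo

/-! ### Torus orbits through the big chart -/

section Orbit

variable {F : Type*} [Field F]

theorem aeval_torsorPoly {R : Type*} [CommRing R] (η : Fin 9 → R) :
    MvPolynomial.aeval η torsorPoly =
      η 0 * η 3 ^ 2 * η 6 + η 2 * η 5 ^ 2 * η 7 + η 4 * η 8 := by
  simp [torsorPoly]

theorem chartCoord_zero {F : Type*} [NormedField F] (p : F × F) :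
    chartCoord 0 p = ![1, 1, 1, 1, 1, 1, p.1, p.2, -p.1 - p.2] := by
  funext j
  fin_cases j <;> simp [chartCoord, chartPoly]

theorem torusAct_apply_eq {R : Type*} [CommRing R] (t : Fin 6 → Rˣ) (η : Fin 9 → R) :
    torusAct t η = ![(t 1 * (t 4)⁻¹ : Rˣ) * η 0,
      (t 0 * (t 1)⁻¹ * (t 2)⁻¹ * (t 3)⁻¹ : Rˣ) * η 1,
      (t 2 * (t 5)⁻¹ : Rˣ) * η 2, (t 4 : Rˣ) * η 3, (t 3 : Rˣ) * η 4, (t 5 : Rˣ) * η 5,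
      (t 0 * (t 1)⁻¹ * (t 4)⁻¹ : Rˣ) * η 6,
      (t 0 * (t 2)⁻¹ * (t 5)⁻¹ : Rˣ) * η 7, (t 0 * (t 3)⁻¹ : Rˣ) * η 8] := by
  funext j
  fin_cases j <;> simp [torusAct, degreeMatrix, Fin.prod_univ_succ, mul_assoc]

/-- The degrees of `η₁, …, η₆` form a basis of `Pic`, so in the orbit of the point with coordinates
`(x, y)` of the big chart these six coordinates are arbitrary nonzero elements, and they determine
the other three. -/
theorem exists_torusAct_iff (x y : F) (η : Fin 9 → F) :
    (∃ t, η = torusAct t ![1, 1, 1, 1, 1, 1, x, y, -x - y]) ↔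
      (∀ j < 6, η j ≠ 0) ∧ η 6 * η 3 = η 1 * η 2 * η 4 * η 5 * x ∧
        η 7 * η 5 = η 0 * η 1 * η 3 * η 4 * y ∧
        η 8 = η 0 * η 1 * η 2 * η 3 * η 5 * (-x - y) := by
  constructor
  · rintro ⟨t, rfl⟩
    rw [torusAct_apply_eq]
    refine ⟨fun j hj => ?_, ?_, ?_, ?_⟩
    · fin_cases j <;> first | exact absurd hj (by decide) | simp
    · simp
      field_simp
    · simp
      field_simp
    · simp
      field_simp
      simp
  · rintro ⟨h, h6, h7, h8⟩
    have h0 := h 0 (by decide)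
    have h1 := h 1 (by decide)
    have h2 := h 2 (by decide)
    have h3 := h 3 (by decide)
    have h4 := h 4 (by decide)
    have h5 := h 5 (by decide)
    -- The exponents are the entries of the inverse of the matrix of the degrees of `η₁, …, η₆`.
    refine ⟨![Units.mk0 (η 1 * (η 0 * η 3) * (η 2 * η 5) * η 4) (by simp [*]),
      Units.mk0 (η 0 * η 3) (by simp [*]), Units.mk0 (η 2 * η 5) (by simp [*]),
      Units.mk0 (η 4) h4, Units.mk0 (η 3) h3, Units.mk0 (η 5) h5], ?_⟩
    rw [torusAct_apply_eq]
    funext j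
    fin_cases j <;> simp <;> field_simp
    · linear_combination h6
    · linear_combination h7
    · linear_combination h8

end Orbit

/-! ### The residue form in the big chart -/

section Chart

variable {F : Type*} [NormedField F]

/-- The degrees of `η₁, …, η₆` form a basis of `Pic`. -/
theorem det_degreeMatrix_basis :
    (degreeMatrix.submatrix id (Fin.castAdd 3)).det = 1 ∨
      (degreeMatrix.submatrix id (Fin.castAdd 3)).det = -1 := by
  refine Int.isUnit_iff.1 (Matrix.isUnit_det_of_right_inverse (B :=
    !![1, 1, 0, 0, 0, 0;
       1, 0, 0, 0, 0, 0;
       1, 0, 1, 0, 0, 0;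
       1, 1, 0, 0, 1, 0;
       1, 0, 0, 1, 0, 0;
       1, 0, 1, 0, 0, 1]) ?_)
  decide

/-- In the big chart `dx ∧ dy = ± Ω`: the matrix of the residue form is block triangular, with the
degrees of `η₁, …, η₆` as one of its diagonal blocks. -/
theorem norm_residueForm_chart_zero (p : F × F) :
    ‖residueForm 8 (chartCoord 0 p) (chartTangent 0 0 p) (chartTangent 0 1 p)‖ = 1 := by
  have h0 : chartTangent 0 0 p = ![0, 0, 0, 0, 0, 0, 1, 0, -1] := by
    funext j
    fin_cases j <;> simp [chartTangent, chartPoly]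
  have h1 : chartTangent 0 1 p = ![0, 0, 0, 0, 0, 0, 0, 1, -1] := by
    funext j
    fin_cases j <;> simp [chartTangent, chartPoly]
  have hd : MvPolynomial.aeval (chartCoord 0 p) (MvPolynomial.pderiv 8 torsorPoly) = 1 := by
    simp [torsorPoly, chartCoord_zero]
  have h8 : (Pi.single 8 1 : Fin 9 → F) = ![0, 0, 0, 0, 0, 0, 0, 0, 1] := by
    funext j
    fin_cases j <;> simp
  unfold residueForm
  rw [hd, h0, h1, h8, chartCoord_zero, div_one]
  set M : Matrix (Fin 9) (Fin 9) F := Matrix.of _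
  -- The columns of `η₇, η₈, η₉` are moved to the front, which changes only the sign.
  let e : Fin 3 ⊕ Fin 6 ≃ Fin 9 := finSumFinEquiv
  let g : Fin 3 ⊕ Fin 6 ≃ Fin 9 := (Equiv.sumComm _ _).trans finSumFinEquiv
  have hblock : M.submatrix e g = Matrix.fromBlocks !![1, 0, -1; 0, 1, -1; 0, 0, 1] 0
      (M.submatrix (e ∘ Sum.inr) (g ∘ Sum.inl))
      ((degreeMatrix.submatrix id (Fin.castAdd 3)).map (Int.castRingHom F)) := by
    rw [Matrix.ext_iff_blocks]
    refine ⟨?_, ?_, rfl, ?_⟩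
    · ext a b
      fin_cases a <;> fin_cases b <;> rfl
    · ext a b
      fin_cases a <;> fin_cases b <;> rfl
    · ext a b
      fin_cases a <;> fin_cases b <;> exact mul_one (M := F) _
  have hsub : M.submatrix e g = (M.submatrix id (e.symm.trans g)).submatrix e e := by
    ext a b
    simp
  have hdet := congrArg Matrix.det hblock
  rw [hsub, Matrix.det_submatrix_equiv_self, Matrix.det_permute', Matrix.det_fromBlocks_zero₁₂,
    ← RingHom.mapMatrix_apply, ← RingHom.map_det] at hdet
  have := congrArg norm hdet
  rw [norm_mul, norm_mul] at this
  rcases Int.units_eq_one_or (Equiv.Perm.sign (e.symm.trans g)) with h | h <;>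
  rcases det_degreeMatrix_basis with h' | h' <;>
  simpa [h, h', Matrix.det_fin_three] using this

end Chart

/-! ### Reduction of the measure to the big chart -/

section Geometry

variable {F : Type*} [NormedField F]

/-- Over a local ring, the `f_k` generate the unit ideal if and only if one of them is a unit. -/
theorem mem_torsorPoints_iff {R : Type*} [CommRing R] [IsLocalRing R] (η : Fin 9 → R) :
    η ∈ torsorPoints R ↔ MvPolynomial.aeval η torsorPoly = 0 ∧
      ∃ k, IsUnit (irrelevantMonomial k η) := by
  refine and_congr_right fun _ => ?_
  constructor
  · intro h
    by_contra! hk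
    refine (IsLocalRing.maximalIdeal.isMaximal R).ne_top (top_le_iff.1 (h ▸ Ideal.span_le.2 ?_))
    rintro _ ⟨k, rfl⟩
    exact hk k
  · rintro ⟨k, hk⟩
    exact Ideal.eq_top_of_isUnit_mem _ (Ideal.subset_span ⟨k, rfl⟩) hk

theorem chartCoord_zero_mem (p : F × F) : chartCoord 0 p ∈ torsorPoints F := by
  rw [mem_torsorPoints_iff, aeval_torsorPoly, chartCoord_zero]
  refine ⟨by simp, 0, ?_⟩
  have : (maximalCliques 0)ᶜ = {0, 1, 2, 3, 4, 5} := by decide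
  simp [irrelevantMonomial, this]

theorem chartDomain_zero : chartDomain F 0 = Set.univ :=
  Set.eq_univ_of_forall chartCoord_zero_mem

/-- The big chart contains the locus where `η₁, …, η₆` do not vanish. -/
theorem mk_mem_range_chartPoint_zero (θ : torsorPoints F) (h : ∀ j < 6, θ.1 j ≠ 0) :
    (Quotient.mk _ θ : SurfacePoints F) ∈ Set.range (chartPoint (F := F) 0) := by
  have h0 := h 0 (by decide)
  have h1 := h 1 (by decide)
  have h2 := h 2 (by decide)
  have h3 := h 3 (by decide)
  have h4 := h 4 (by decide)
  have h5 := h 5 (by decide)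
  have hg := θ.2.1
  rw [aeval_torsorPoly] at hg
  set η := θ.1
  let p : F × F := (η 3 * η 6 / (η 1 * η 2 * η 4 * η 5), η 5 * η 7 / (η 0 * η 1 * η 3 * η 4))
  refine ⟨⟨p, chartCoord_zero_mem p⟩, Quotient.sound ?_⟩
  change ∃ t, η = torusAct t (chartCoord 0 p)
  rw [chartCoord_zero, exists_torusAct_iff]
  refine ⟨h, ?_, ?_, ?_⟩
  · simp only [p]
    field_simp
  · simp only [p]
    field_simp
  · simp only [p]
    field_simp
    linear_combination hg

theorem continuous_chartCoord (k : Fin 9) : Continuous (chartCoord (F := F) k) := by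
  refine continuous_pi fun j => ?_
  simp only [chartCoord, MvPolynomial.aeval_def, MvPolynomial.eval₂_eq_eval_map]
  refine (MvPolynomial.continuous_eval _).comp (continuous_pi fun m => ?_)
  fin_cases m
  exacts [continuous_fst, continuous_snd]

theorem continuous_irrelevantMonomial (k : Fin 9) :
    Continuous fun η : Fin 9 → F => irrelevantMonomial k η := by
  unfold irrelevantMonomial
  fun_prop

theorem newChartPart_zero : newChartPart F 0 = Set.univ :=
  Set.eq_univ_of_forall fun _ j hj => absurd hj (by simp)

/-- The points of another chart that are not in the big chart lie on its coordinate axes, since its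
coordinates include all those of `η₁, …, η₆` that are not set to `1`. -/
theorem newChartPart_subset {k : Fin 9} (hk : k ≠ 0) {p : chartDomain F k}
    (hp : p ∈ newChartPart F k) : p.1.1 = 0 ∨ p.1.2 = 0 := by
  by_contra! h
  refine hp 0 (Fin.pos_of_ne_zero hk) (mk_mem_range_chartPoint_zero _ fun j hj => ?_)
  change chartCoord k p.1 j ≠ 0
  obtain ⟨⟨a, b⟩, hp'⟩ := p
  obtain ⟨h1, h2⟩ := h
  simp only at h1 h2
  clear hp
  revert hj
  fin_cases k <;> first | exact absurd rfl hk | skip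
  all_goals
    fin_cases j <;> first
      | exact fun hj => absurd hj (by decide)
      | simp [chartCoord, chartPoly, h1, h2]

section Measure

variable [MeasurableSpace F] [BorelSpace F] [SecondCountableTopology F]

/-- `Measure.comap` along the inclusion has its meaning only because this set is measurable. -/
theorem measurableSet_chartDomain (k : Fin 9) : MeasurableSet (chartDomain F k) := by
  have : torsorPoints F = {η | η 0 * η 3 ^ 2 * η 6 + η 2 * η 5 ^ 2 * η 7 + η 4 * η 8 = 0} ∩
      ⋃ k, {η | irrelevantMonomial k η ≠ 0} := by
    ext η
    simp [mem_torsorPoints_iff, aeval_torsorPoly]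
  have hm : MeasurableSet (torsorPoints F) := by
    rw [this]
    refine (isClosed_eq (by fun_prop) continuous_const).measurableSet.inter
      (MeasurableSet.iUnion fun k => ?_)
    exact (isOpen_ne_fun (continuous_irrelevantMonomial k) continuous_const).measurableSet
  exact (continuous_chartCoord k).measurable hm

theorem measurable_chartPoint (k : Fin 9) : Measurable (chartPoint (F := F) k) :=
  measurable_quotient_mk''.comp
    ((continuous_chartCoord k).measurable.comp measurable_subtype_coe).subtype_mk

/-- As the complement of the big chart is a null set, the Tamagawa measure is computed by an
integral over the plane of this chart. -/
theorem tamagawaMeasure_apply (μ : Measure F) [SFinite μ] (hμ : μ {0} = 0) (i : Boundary)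
    {A : Set (SurfacePoints F)} (hA : MeasurableSet A) :
    tamagawaMeasure μ i A =
      ∫⁻ p in {p | chartPoint 0 ⟨p, chartCoord_zero_mem p⟩ ∈ A},
        (ENNReal.ofReal (chartNorm i 0 p))⁻¹ ∂μ.prod μ := by
  have hnull : (μ.prod μ) {p | p.1 = 0 ∨ p.2 = 0} = 0 := by
    have : {p : F × F | p.1 = 0 ∨ p.2 = 0} = ({0} ×ˢ Set.univ) ∪ (Set.univ ×ˢ {0}) := by
      ext p
      simp
    rw [this, measure_union_null_iff]
    simp [hμ]
  rw [tamagawaMeasure, Measure.sum_apply _ hA, tsum_fintype, Finset.sum_eq_single 0]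
  · rw [newChartPart_zero, Measure.restrict_univ, Measure.map_apply (measurable_chartPoint 0) hA,
      (MeasurableEmbedding.subtype_coe (measurableSet_chartDomain 0)).comap_apply,
      withDensity_apply']
    congr 2
    ext p
    simp [chartDomain_zero]
  · intro k _ hk
    rw [Measure.map_apply (measurable_chartPoint k) hA]
    refine measure_mono_null (Set.subset_univ _) ?_
    rw [Measure.restrict_apply_univ,
      (MeasurableEmbedding.subtype_coe (measurableSet_chartDomain k)).comap_apply]
    refine withDensity_absolutelyContinuous _ _ (measure_mono_null ?_ hnull)
    rintro _ ⟨p, hp, rfl⟩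
    exact newChartPart_subset hk hp
  · simp

end Measure
end Geometry

/-! ### Integral points in the big chart -/

section Integral

variable {F : Type*} [NormedField F]

/-- The conditions, in terms of norms, for a point `η` of the torsor over `F` to come from an
integral point of the torsor with `η_j` a unit for every component `E_j` of `D_i`. The equation of
the torsor is not included. -/
def IsIntegralLift (i : Boundary) (η : Fin 9 → F) : Prop :=
  (∀ j, ‖η j‖ ≤ 1) ∧ (∃ k, ‖irrelevantMonomial k η‖ = 1) ∧ ∀ j ∈ boundaryComponents i, ‖η j‖ = 1

theorem torusAct_mem_torsorPoints {t : Fin 6 → Fˣ} {η : Fin 9 → F} (h : η ∈ torsorPoints F) :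
    torusAct t η ∈ torsorPoints F := by
  rw [mem_torsorPoints_iff] at h ⊢
  obtain ⟨hg, k, hk⟩ := h
  refine ⟨?_, k, ?_⟩
  · rw [aeval_torsorPoly] at hg ⊢
    rw [torusAct_apply_eq]
    simp
    field_simp
    linear_combination (t 0 : F) * hg
  · simp only [irrelevantMonomial, isUnit_iff_ne_zero, Finset.prod_ne_zero_iff] at hk ⊢
    exact fun j hj => mul_ne_zero (Units.ne_zero _) (hk j hj)

/-- Integrality of a torus orbit in terms of norms; `hmem` and `hunit` say that `R` is
the valuation ring of `F`. -/
theorem mk_mem_integralPoints_iff {R : Type*} [CommRing R] [IsLocalRing R] [Algebra R F]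
    (hinj : Function.Injective (algebraMap R F))
    (hmem : ∀ x : F, ‖x‖ ≤ 1 ↔ ∃ r : R, algebraMap R F r = x)
    (hunit : ∀ r : R, IsUnit r ↔ ‖algebraMap R F r‖ = 1) (i : Boundary) (θ : torsorPoints F) :
    (Quotient.mk _ θ : SurfacePoints F) ∈ integralPoints R F i ↔
      ∃ t : Fin 6 → Fˣ, IsIntegralLift i (torusAct t θ.1) := by
  constructor
  · rintro ⟨η, θ', hD, hη, hθ⟩
    obtain ⟨t, ht⟩ := Quotient.exact hθ
    refine ⟨t, ?_⟩
    rw [← ht]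
    refine ⟨fun j => (hmem _).2 ⟨_, (hη j).symm⟩, ?_, fun j hj => ?_⟩
    · obtain ⟨-, k, hk⟩ := (mem_torsorPoints_iff _).1 η.2
      refine ⟨k, ?_⟩
      rw [hunit] at hk
      simpa [irrelevantMonomial, hη] using hk
    · rw [hη, ← hunit]
      exact hD j hj
  · rintro ⟨t, h1, ⟨k, hk⟩, hD⟩
    choose η hη using fun j => (hmem _).1 (h1 j)
    have hmon : algebraMap R F (irrelevantMonomial k η) =
        irrelevantMonomial k (torusAct t θ.1) := by
      simp [irrelevantMonomial, hη]
    have hθ := torusAct_mem_torsorPoints (t := t) θ.2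
    refine ⟨⟨η, (mem_torsorPoints_iff _).2 ⟨hinj ?_, k, ?_⟩⟩, ⟨_, hθ⟩, fun j hj => ?_,
      fun j => (hη j).symm, Quotient.sound ⟨t, rfl⟩⟩
    · rw [map_zero, ← hθ.1, aeval_torsorPoly, aeval_torsorPoly]
      simp [hη]
    · rw [hunit, hmon, hk]
    · rw [hunit, hη]
      exact hD j hj

/-- The preimage of the set of integral points in the torsor is open: it is the union of the
translates of an open set by the elements of the torus. -/
theorem measurableSet_integralPoints [MeasurableSpace F] [BorelSpace F]
    [SecondCountableTopology F] [IsUltrametricDist F]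
    {R : Type*} [CommRing R] [IsLocalRing R] [Algebra R F]
    (hinj : Function.Injective (algebraMap R F))
    (hmem : ∀ x : F, ‖x‖ ≤ 1 ↔ ∃ r : R, algebraMap R F r = x)
    (hunit : ∀ r : R, IsUnit r ↔ ‖algebraMap R F r‖ = 1) (i : Boundary) :
    MeasurableSet (integralPoints R F i) := by
  rw [measurableSet_quotient]
  refine IsOpen.measurableSet ?_
  have hball : IsOpen {x : F | ‖x‖ ≤ 1} := by
    simpa [Metric.closedBall] using IsUltrametricDist.isOpen_closedBall (0 : F) one_ne_zero
  have hsphere : IsOpen {x : F | ‖x‖ = 1} := by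
    simpa [Metric.sphere] using IsUltrametricDist.isOpen_sphere (0 : F) one_ne_zero
  have hopen : IsOpen {η : Fin 9 → F | IsIntegralLift i η} := by
    have : {η : Fin 9 → F | IsIntegralLift i η} = (⋂ j, {η | ‖η j‖ ≤ 1}) ∩
        ((⋃ k, {η | ‖irrelevantMonomial k η‖ = 1}) ∩
          ⋂ j ∈ boundaryComponents i, {η | ‖η j‖ = 1}) := by
      ext η
      simp [IsIntegralLift]
    rw [this]
    refine IsOpen.inter ?_ (IsOpen.inter ?_ ?_)
    · exact isOpen_iInter_of_finite fun j =>
        hball.preimage (f := fun η : Fin 9 → F => η j) (continuous_apply j)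
    · exact isOpen_iUnion fun k => hsphere.preimage (continuous_irrelevantMonomial k)
    · exact isOpen_iInter_of_finite fun j => isOpen_iInter_of_finite fun _ =>
        hsphere.preimage (f := fun η : Fin 9 → F => η j) (continuous_apply j)
  have : (Quotient.mk'' ⁻¹' integralPoints R F i : Set (torsorPoints F)) =
      ⋃ t : Fin 6 → Fˣ, {θ | IsIntegralLift i (torusAct t θ.1)} := by
    ext θ
    rw [Set.mem_iUnion]
    exact mk_mem_integralPoints_iff hinj hmem hunit i θ
  rw [this]
  refine isOpen_iUnion fun t => hopen.preimage (f := fun θ : torsorPoints F => torusAct t θ.1) ?_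
  exact continuous_pi fun j =>
    continuous_const.mul ((continuous_apply j).comp continuous_subtype_val)

/-- The points at which `η₄, η₅, η₆` are units for an integral lift. -/
def innerRegion (F : Type*) [NormedField F] : Set (F × F) := {p | ‖p.1‖ ≤ 1 ∧ ‖p.2‖ ≤ 1}

/-- The points at which `η₆` is not a unit for an integral lift. -/
def regionFst (F : Type*) [NormedField F] : Set (F × F) := {p | 1 < ‖p.1‖ ∧ ‖p.1 * p.2‖ ≤ 1}

/-- The points at which `η₄` is not a unit for an integral lift. -/
def regionSnd (F : Type*) [NormedField F] : Set (F × F) := {p | 1 < ‖p.2‖ ∧ ‖p.1 * p.2‖ ≤ 1}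

/-- The points at which `η₅` is not a unit for an integral lift. -/
def regionDiag (F : Type*) [NormedField F] : Set (F × F) := {p | 1 < ‖p.1‖ ∧ ‖p.1 + p.2‖ ≤ 1}

/-- The set of integral points `𝒰̃_i` in the big chart. For `D₂` the coordinate `η₄` must be a unit,
which excludes `regionSnd`. -/
def integralRegion (F : Type*) [NormedField F] : Boundary → Set (F × F)
  | .singularity => innerRegion F ∪ (regionFst F ∪ (regionDiag F ∪ regionSnd F))
  | .line => innerRegion F ∪ (regionFst F ∪ regionDiag F)

/-- Coordinates outside one of the maximal cliques are units. Whichever the clique, at most one of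
`η₄, η₅, η₆` is not a unit, and if `η₄` is not one, then `η₈` is; if `η₅` or `η₆` is not one, then
`η₇` is. -/
theorem isIntegralLift_norm_cases {i : Boundary} {η : Fin 9 → F} (h : IsIntegralLift i η) :
    ‖η 0‖ = 1 ∧ ‖η 1‖ = 1 ∧ ‖η 2‖ = 1 ∧ (i = .line → ‖η 3‖ = 1) ∧
    ((‖η 3‖ = 1 ∧ ‖η 4‖ = 1 ∧ ‖η 5‖ = 1) ∨ (‖η 4‖ = 1 ∧ ‖η 5‖ = 1 ∧ ‖η 7‖ = 1) ∨
      (‖η 3‖ = 1 ∧ ‖η 5‖ = 1 ∧ ‖η 6‖ = 1) ∨ (‖η 3‖ = 1 ∧ ‖η 4‖ = 1 ∧ ‖η 6‖ = 1)) := by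
  obtain ⟨h1, ⟨k, hk⟩, hD⟩ := h
  have hu : ∀ j ∈ (maximalCliques k)ᶜ, ‖η j‖ = 1 := by
    intro j hj
    refine (h1 j).antisymm ?_
    rw [← hk, irrelevantMonomial, norm_prod, ← Finset.mul_prod_erase _ _ hj]
    exact mul_le_of_le_one_right (norm_nonneg _)
      (Finset.prod_le_one (fun _ _ => norm_nonneg _) fun j _ => h1 j)
  refine ⟨hD 0 ?_, hD 1 ?_, hD 2 ?_, fun hi => hD 3 ?_, ?_⟩
  · cases i <;> decide
  · cases i <;> decide
  · cases i <;> decide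
  · subst hi
    decide
  · clear hk
    fin_cases k <;> simp only [Fin.reduceFinMk] at hu
    · exact .inl ⟨hu 3 (by decide), hu 4 (by decide), hu 5 (by decide)⟩
    · exact .inl ⟨hu 3 (by decide), hu 4 (by decide), hu 5 (by decide)⟩
    · exact .inr (.inl ⟨hu 4 (by decide), hu 5 (by decide), hu 7 (by decide)⟩)
    · exact .inl ⟨hu 3 (by decide), hu 4 (by decide), hu 5 (by decide)⟩
    · exact .inr (.inr (.inl ⟨hu 3 (by decide), hu 5 (by decide), hu 6 (by decide)⟩))
    · exact .inr (.inr (.inr ⟨hu 3 (by decide), hu 4 (by decide), hu 6 (by decide)⟩))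
    · exact .inr (.inl ⟨hu 4 (by decide), hu 5 (by decide), hu 7 (by decide)⟩)
    · exact .inr (.inr (.inl ⟨hu 3 (by decide), hu 5 (by decide), hu 6 (by decide)⟩))
    · exact .inr (.inr (.inr ⟨hu 3 (by decide), hu 4 (by decide), hu 6 (by decide)⟩))

/-- One inclusion of the description of the integral points in the big chart. -/
theorem mem_integralRegion_of_lift {i : Boundary} {x y : F} {t : Fin 6 → Fˣ}
    (h : IsIntegralLift i (torusAct t ![1, 1, 1, 1, 1, 1, x, y, -x - y])) :
    (x, y) ∈ integralRegion F i := by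
  generalize hη : torusAct t ![1, 1, 1, 1, 1, 1, x, y, -x - y] = η at h
  obtain ⟨-, h6, h7, h8⟩ := (exists_torusAct_iff x y η).1 ⟨t, hη.symm⟩
  obtain ⟨n0, n1, n2, n3, hcase⟩ := isIntegralLift_norm_cases h
  have b := h.1
  have e6 := congrArg norm h6
  have e7 := congrArg norm h7
  have e8 := congrArg norm h8
  rw [show -x - y = -(x + y) by ring] at e8
  simp only [norm_mul, n0, n1, n2, one_mul, norm_neg] at e6 e7 e8
  suffices H : (‖x‖ ≤ 1 ∧ ‖y‖ ≤ 1) ∨ (1 < ‖x‖ ∧ ‖x‖ * ‖y‖ ≤ 1) ∨ (1 < ‖x‖ ∧ ‖x + y‖ ≤ 1) ∨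
      (‖η 3‖ ≠ 1 ∧ 1 < ‖y‖ ∧ ‖x‖ * ‖y‖ ≤ 1) by
    cases i
    · simp only [integralRegion, innerRegion, regionFst, regionSnd, regionDiag, Set.mem_union,
        Set.mem_ofPred_eq, norm_mul]
      tauto
    · have := n3 rfl
      simp only [integralRegion, innerRegion, regionFst, regionDiag, Set.mem_union,
        Set.mem_ofPred_eq, norm_mul]
      tauto
  rcases hcase with ⟨a3, a4, a5⟩ | ⟨a4, a5, a7⟩ | ⟨a3, a5, a6⟩ | ⟨a3, a4, a6⟩
  · left
    simp only [a3, a4, a5, one_mul, mul_one] at e6 e7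
    exact ⟨e6 ▸ b 6, e7 ▸ b 7⟩
  · simp only [a4, a5, a7, one_mul, mul_one] at e6 e7
    have hxy : ‖x‖ * ‖y‖ = ‖η 6‖ := by
      rw [← e6, mul_assoc, ← e7, mul_one]
    by_cases h3 : ‖η 3‖ = 1
    · left
      rw [h3, mul_one] at e6
      rw [h3, one_mul] at e7
      exact ⟨e6 ▸ b 6, e7.symm.le⟩
    · refine .inr (.inr (.inr ⟨h3, ?_, hxy.trans_le (b 6)⟩))
      by_contra! hy
      have := b 3
      have h3' := lt_of_le_of_ne this h3
      nlinarith [norm_nonneg (η 3), norm_nonneg y]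
  · simp only [a3, a5, a6, one_mul, mul_one] at e6 e7 e8
    rcases le_or_gt ‖x‖ 1 with hx | hx
    · have h4 : ‖η 4‖ = 1 := by
        refine (b 4).antisymm ?_
        nlinarith [norm_nonneg (η 4), norm_nonneg x]
      rw [h4, one_mul] at e7
      exact .inl ⟨hx, e7 ▸ b 7⟩
    · exact .inr (.inr (.inl ⟨hx, e8 ▸ b 8⟩))
  · simp only [a3, a4, a6, one_mul, mul_one] at e6 e7 e8
    rcases le_or_gt ‖x‖ 1 with hx | hx
    · have h5 : ‖η 5‖ = 1 := by
        refine (b 5).antisymm ?_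
        nlinarith [norm_nonneg (η 5), norm_nonneg x]
      rw [h5, mul_one] at e7
      exact .inl ⟨hx, e7 ▸ b 7⟩
    · refine .inr (.inl ⟨hx, ?_⟩)
      rw [← e7, mul_left_comm, mul_comm ‖x‖, ← e6, mul_one]
      exact b 7

theorem isIntegralLift_of_clique {i : Boundary} {η : Fin 9 → F} (k : Fin 9) (h1 : ∀ j, ‖η j‖ ≤ 1)
    (hk : ∀ j ∉ maximalCliques k, ‖η j‖ = 1) (hD : ∀ j ∈ boundaryComponents i, ‖η j‖ = 1) :
    IsIntegralLift i η :=
  ⟨h1, ⟨k, by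
    rw [irrelevantMonomial, norm_prod]
    exact Finset.prod_eq_one fun j hj => hk j (by simpa using hj)⟩, hD⟩

theorem norm_neg_one_sub_div_of_norm_mul_le [IsUltrametricDist F] {x y : F} (hx : 1 < ‖x‖)
    (hxy : ‖x * y‖ ≤ 1) : ‖-1 - y / x‖ = 1 := by
  have h : ‖y / x‖ < 1 := by
    rw [norm_div, div_lt_one (one_pos.trans hx)]
    rw [norm_mul] at hxy
    nlinarith
  rw [← neg_add', norm_neg, IsUltrametricDist.norm_add_eq_max_of_norm_ne_norm
      (by simpa only [norm_one] using h.ne'), norm_one, max_eq_left h.le]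

/-- The other inclusion of the description of the integral points in the big chart: on each piece,
an integral lift with `η₁ = η₂ = η₃ = 1` is written down, whose nonunit coordinates lie in the
clique `{7, 8, 9}`, `{6, 8}`, `{5, 9}` or `{4, 7}`. -/
theorem exists_lift_of_mem_integralRegion [IsUltrametricDist F] {i : Boundary} {x y : F}
    (h : (x, y) ∈ integralRegion F i) :
    ∃ t : Fin 6 → Fˣ, IsIntegralLift i (torusAct t ![1, 1, 1, 1, 1, 1, x, y, -x - y]) := by
  suffices H : ∃ η : Fin 9 → F, IsIntegralLift i η ∧ (∀ j < 6, η j ≠ 0) ∧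
      η 6 * η 3 = η 1 * η 2 * η 4 * η 5 * x ∧ η 7 * η 5 = η 0 * η 1 * η 3 * η 4 * y ∧
        η 8 = η 0 * η 1 * η 2 * η 3 * η 5 * (-x - y) by
    obtain ⟨η, hη, h⟩ := H
    obtain ⟨t, rfl⟩ := (exists_torusAct_iff x y η).2 h
    exact ⟨t, hη⟩
  have hcase : (‖x‖ ≤ 1 ∧ ‖y‖ ≤ 1) ∨ (1 < ‖x‖ ∧ ‖x * y‖ ≤ 1) ∨ (1 < ‖x‖ ∧ ‖x + y‖ ≤ 1) ∨
      (i = .singularity ∧ 1 < ‖y‖ ∧ ‖x * y‖ ≤ 1) := by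
    cases i
    · simpa only [integralRegion, innerRegion, regionFst, regionSnd, regionDiag, Set.mem_union,
        Set.mem_ofPred_eq, true_and] using h
    · simpa only [integralRegion, innerRegion, regionFst, regionSnd, regionDiag, Set.mem_union,
        Set.mem_ofPred_eq, reduceCtorEq, false_and, or_false] using h
  rcases hcase with ⟨hx, hy⟩ | ⟨hx, hxy⟩ | ⟨hx, hxy⟩ | ⟨rfl, hy, hxy⟩
  · have hs : ‖-x - y‖ ≤ 1 := by
      rw [sub_eq_add_neg]
      refine (IsUltrametricDist.norm_add_le_max _ _).trans (max_le ?_ ?_) <;> rwa [norm_neg]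
    refine ⟨![1, 1, 1, 1, 1, 1, x, y, -x - y], isIntegralLift_of_clique 0 ?_ ?_ ?_, ?_, by simp,
      by simp, by simp⟩
    · intro j
      fin_cases j <;> simp <;> assumption
    · intro j hj
      fin_cases j <;> first | exact absurd hj (by decide) | simp
    · intro j hj
      cases i <;> fin_cases j <;> first | exact absurd hj (by decide) | simp
    · intro j hj
      fin_cases j <;> first | exact absurd hj (by decide) | simp
  · have h0 : x ≠ 0 := norm_pos_iff.1 (one_pos.trans hx)
    have hi : ‖x‖⁻¹ ≤ 1 := inv_le_one_of_one_le₀ hx.le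
    have hs : ‖-1 - y / x‖ = 1 := norm_neg_one_sub_div_of_norm_mul_le hx hxy
    -- `η₆ = 1 / x`, and `η₆`, `η₈` are the possible nonunits.
    refine ⟨![1, 1, 1, 1, 1, x⁻¹, 1, x * y, -1 - y / x], isIntegralLift_of_clique 8 ?_ ?_ ?_,
      ?_, ?_, ?_, ?_⟩
    · intro j
      fin_cases j <;> simp [hs, hi, -norm_mul, hxy]
    · intro j hj
      fin_cases j <;> first | exact absurd hj (by decide) | simp [hs]
    · intro j hj
      cases i <;> fin_cases j <;> first | exact absurd hj (by decide) | simp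
    · intro j hj
      fin_cases j <;> first | exact absurd hj (by decide) | simp [h0]
    all_goals
      simp
      try field_simp
  · have h0 : x ≠ 0 := norm_pos_iff.1 (one_pos.trans hx)
    have hi : ‖x‖⁻¹ ≤ 1 := inv_le_one_of_one_le₀ hx.le
    have hs : ‖y / x‖ = 1 := by
      have : ‖x‖ = ‖y‖ := IsUltrametricDist.norm_eq_of_add_norm_lt_max
        (hxy.trans_lt (hx.trans_le (le_max_left _ _)))
      rw [norm_div, ← this, div_self (norm_ne_zero_iff.2 h0)]
    have hn : ‖-x - y‖ ≤ 1 := by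
      rwa [← neg_add', norm_neg]
    -- `η₅ = 1 / x`, and `η₅`, `η₉` are the possible nonunits.
    refine ⟨![1, 1, 1, 1, x⁻¹, 1, 1, y / x, -x - y], isIntegralLift_of_clique 7 ?_ ?_ ?_,
      ?_, ?_, ?_, ?_⟩
    · intro j
      fin_cases j <;> simp [hs, hi, hn, -norm_div]
    · intro j hj
      fin_cases j <;> first | exact absurd hj (by decide) | simp [hs, -norm_div]
    · intro j hj
      cases i <;> fin_cases j <;> first | exact absurd hj (by decide) | simp
    · intro j hj
      fin_cases j <;> first | exact absurd hj (by decide) | simp [h0]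
    all_goals
      simp
      try field_simp
  · have h0 : y ≠ 0 := norm_pos_iff.1 (one_pos.trans hy)
    have hi : ‖y‖⁻¹ ≤ 1 := inv_le_one_of_one_le₀ hy.le
    have hs : ‖-1 - x / y‖ = 1 :=
      norm_neg_one_sub_div_of_norm_mul_le hy (by rwa [mul_comm])
    -- `η₄ = 1 / y`, and `η₄`, `η₇` are the possible nonunits.
    refine ⟨![1, 1, 1, y⁻¹, 1, 1, x * y, 1, -1 - x / y], isIntegralLift_of_clique 6 ?_ ?_ ?_,
      ?_, ?_, ?_, ?_⟩
    · intro j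
      fin_cases j <;> simp [hs, hi, -norm_mul, hxy]
    · intro j hj
      fin_cases j <;> first | exact absurd hj (by decide) | simp [hs]
    · intro j hj
      fin_cases j <;> first | exact absurd hj (by decide) | simp
    · intro j hj
      fin_cases j <;> first | exact absurd hj (by decide) | simp [h0]
    all_goals
      simp
      try field_simp
    ring

end Integral

/-! ### The density on the pieces -/

section Density

variable {F : Type*} [NormedField F]

/-- On the big chart `1_{D_i} = 1` and `dx ∧ dy = ± Ω`, so only the maximum of the
sections remains. -/
theorem chartNorm_zero (i : Boundary) (p : F × F) :
    chartNorm i 0 p = maxSectionNorm i ![1, 1, 1, 1, 1, 1, p.1, p.2, -p.1 - p.2] := by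
  have h : ∏ j ∈ boundaryComponents i, chartCoord 0 p j = 1 := by
    refine Finset.prod_eq_one fun j hj => ?_
    rw [chartCoord_zero]
    cases i <;> fin_cases j <;> first | exact absurd hj (by decide) | rfl
  rw [chartNorm, logCanonicalNorm, h, mul_one, norm_inv]
  change ‖residueForm 8 _ _ _‖⁻¹ * _ = _
  rw [norm_residueForm_chart_zero, inv_one, one_mul, chartCoord_zero]

theorem chartNorm_singularity (x y : F) :
    chartNorm .singularity 0 (x, y) = max (max ‖x‖ ‖y‖) (max 1 (‖x‖ * ‖y‖)) := by
  simp [chartNorm_zero, maxSectionNorm]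

theorem chartNorm_line (x y : F) :
    chartNorm .line 0 (x, y) = max (max ‖x‖ 1) (‖x‖ * ‖y‖) := by
  simp [chartNorm_zero, maxSectionNorm]

theorem chartNorm_of_mem_innerRegion (i : Boundary) {p : F × F} (hp : p ∈ innerRegion F) :
    chartNorm i 0 p = 1 := by
  obtain ⟨hx, hy⟩ := hp
  have hxy : ‖p.1‖ * ‖p.2‖ ≤ 1 := mul_le_one₀ hx (norm_nonneg _) hy
  cases i
  · rw [← Prod.mk.eta (p := p), chartNorm_singularity, max_eq_left hxy,
      max_eq_right (max_le hx hy)]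
  · rw [← Prod.mk.eta (p := p), chartNorm_line, max_eq_right hx, max_eq_left hxy]

theorem chartNorm_of_mem_regionFst (i : Boundary) {p : F × F} (hp : p ∈ regionFst F) :
    chartNorm i 0 p = ‖p.1‖ := by
  obtain ⟨hx, hxy⟩ := hp
  rw [norm_mul] at hxy
  have hy : ‖p.2‖ ≤ ‖p.1‖ := by nlinarith [norm_nonneg p.2]
  cases i
  · rw [← Prod.mk.eta (p := p), chartNorm_singularity, max_eq_left hxy, max_eq_left hy,
      max_eq_left hx.le]
  · rw [← Prod.mk.eta (p := p), chartNorm_line, max_eq_left hx.le, max_eq_left (hxy.trans hx.le)]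

theorem chartNorm_of_mem_regionSnd {p : F × F} (hp : p ∈ regionSnd F) :
    chartNorm .singularity 0 p = ‖p.2‖ := by
  obtain ⟨hy, hxy⟩ := hp
  rw [norm_mul] at hxy
  have hx : ‖p.1‖ ≤ ‖p.2‖ := by nlinarith [norm_nonneg p.1]
  rw [← Prod.mk.eta (p := p), chartNorm_singularity, max_eq_left hxy, max_eq_right hx,
      max_eq_left hy.le]

theorem norm_eq_of_mem_regionDiag [IsUltrametricDist F] {p : F × F} (hp : p ∈ regionDiag F) :
    ‖p.1‖ = ‖p.2‖ :=
  IsUltrametricDist.norm_eq_of_add_norm_lt_max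
    (hp.2.trans_lt (hp.1.trans_le (le_max_left _ _)))

theorem chartNorm_of_mem_regionDiag [IsUltrametricDist F] (i : Boundary) {p : F × F}
    (hp : p ∈ regionDiag F) : chartNorm i 0 p = ‖p.1‖ ^ 2 := by
  have h := norm_eq_of_mem_regionDiag hp
  have h1 : 1 < ‖p.1‖ := hp.1
  have h2 : ‖p.1‖ ≤ ‖p.1‖ ^ 2 := by nlinarith
  cases i
  · rw [← Prod.mk.eta (p := p), chartNorm_singularity, ← h, max_self, ← sq,
      max_eq_right (h1.le.trans h2), max_eq_right h2]
  · rw [← Prod.mk.eta (p := p), chartNorm_line, ← h, max_eq_left h1.le, ← sq, max_eq_right h2]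

theorem disjoint_innerRegion :
    Disjoint (innerRegion F) (regionFst F ∪ (regionDiag F ∪ regionSnd F)) := by
  refine Set.disjoint_left.2 ?_
  rintro p ⟨h1, h2⟩ (h | h | h)
  exacts [h1.not_gt h.1, h1.not_gt h.1, h2.not_gt h.1]

theorem disjoint_regionFst [IsUltrametricDist F] :
    Disjoint (regionFst F) (regionDiag F ∪ regionSnd F) := by
  refine Set.disjoint_left.2 ?_
  rintro p ⟨h1, h2⟩ h
  rw [norm_mul] at h2
  have h3 : 1 < ‖p.2‖ := by
    rcases h with h | h
    · rw [← norm_eq_of_mem_regionDiag h]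
      exact h1
    · exact h.1
  nlinarith

theorem disjoint_regionDiag [IsUltrametricDist F] : Disjoint (regionDiag F) (regionSnd F) := by
  refine Set.disjoint_left.2 ?_
  rintro p h ⟨h2, h3⟩
  have h1 : 1 < ‖p.1‖ := h.1
  rw [norm_mul] at h3
  nlinarith

end Density

/-! ### The integrals

The hypotheses `hnorm` and `hball` say that nonzero norms are integral powers of `q`, and that a ball
of radius `qⁿ` has volume `qⁿ`. -/

section Integrals

variable {F : Type*} [NormedField F] [MeasurableSpace F] {μ : Measure F} {q : ℝ}

theorem measure_singleton_zero (hq : 1 < q)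
    (hball : ∀ n : ℤ, μ {x | ‖x‖ ≤ q ^ n} = ENNReal.ofReal (q ^ n)) : μ {0} = 0 := by
  refine le_antisymm (ge_of_tendsto' (f := fun n : ℕ => ENNReal.ofReal ((q⁻¹) ^ n))
    (x := Filter.atTop) ?_ fun n => ?_) zero_le
  · rw [← ENNReal.ofReal_zero]
    exact (ENNReal.continuous_ofReal.tendsto 0).comp
      (tendsto_pow_atTop_nhds_zero_of_lt_one (by positivity) (inv_lt_one_of_one_lt₀ hq))
  · have := hball (-n)
    rw [zpow_neg, zpow_natCast, ← inv_pow] at this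
    rw [← this]
    refine measure_mono ?_
    simp only [Set.singleton_subset_iff, Set.mem_ofPred_eq, norm_zero]
    positivity

theorem measure_norm_le_inv (hnorm : ∀ x : F, x ≠ 0 → ∃ n : ℤ, ‖x‖ = q ^ n)
    (hball : ∀ n : ℤ, μ {x | ‖x‖ ≤ q ^ n} = ENNReal.ofReal (q ^ n)) {x : F} (hx : x ≠ 0) :
    μ {y | ‖y‖ ≤ ‖x‖⁻¹} = ENNReal.ofReal ‖x‖⁻¹ := by
  obtain ⟨n, hn⟩ := hnorm x hx
  rw [hn, ← zpow_neg, hball]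

variable [BorelSpace F]

theorem measure_norm_eq_zpow (hq : 1 < q) (hnorm : ∀ x : F, x ≠ 0 → ∃ n : ℤ, ‖x‖ = q ^ n)
    (hball : ∀ n : ℤ, μ {x | ‖x‖ ≤ q ^ n} = ENNReal.ofReal (q ^ n)) (n : ℤ) :
    μ {x | ‖x‖ = q ^ n} = ENNReal.ofReal (q ^ n - q ^ (n - 1)) := by
  have hq0 : 0 < q := one_pos.trans hq
  have h : {x : F | ‖x‖ = q ^ n} = {x | ‖x‖ ≤ q ^ n} \ {x | ‖x‖ ≤ q ^ (n - 1)} := by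
    ext x
    simp only [Set.mem_ofPred_eq, Set.mem_sdiff, not_le]
    constructor
    · rintro h
      exact ⟨h.le, h ▸ zpow_lt_zpow_right₀ hq (by omega)⟩
    · rintro ⟨h1, h2⟩
      obtain ⟨m, hm⟩ := hnorm x (norm_pos_iff.1 ((zpow_pos hq0 _).trans h2))
      rw [hm] at h1 h2 ⊢
      rw [zpow_le_zpow_iff_right₀ hq] at h1
      rw [zpow_lt_zpow_iff_right₀ hq] at h2
      congr 1
      omega
  rw [h, measure_sdiff, hball, hball, ENNReal.ofReal_sub _ (by positivity)]
  · intro x hx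
    exact le_trans (show ‖x‖ ≤ _ from hx) (zpow_le_zpow_right₀ hq.le (by omega))
  · exact (measurableSet_le measurable_norm measurable_const).nullMeasurableSet
  · rw [hball]
    exact ENNReal.ofReal_ne_top

/-- The integral is `∑ q⁻²ⁿ (qⁿ - qⁿ⁻¹)` over `n ≥ 1`. The integrals over the three unbounded pieces
reduce to this one. -/
theorem lintegral_inv_norm_sq (hq : 1 < q) (hnorm : ∀ x : F, x ≠ 0 → ∃ n : ℤ, ‖x‖ = q ^ n)
    (hball : ∀ n : ℤ, μ {x | ‖x‖ ≤ q ^ n} = ENNReal.ofReal (q ^ n)) :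
    ∫⁻ x in {x | 1 < ‖x‖}, (ENNReal.ofReal (‖x‖ ^ 2))⁻¹ ∂μ = ENNReal.ofReal q⁻¹ := by
  have hq0 : 0 < q := one_pos.trans hq
  have hunion : {x : F | 1 < ‖x‖} = ⋃ n : ℕ, {x | ‖x‖ = q ^ ((n : ℤ) + 1)} := by
    ext x
    simp only [Set.mem_ofPred_eq, Set.mem_iUnion]
    constructor
    · intro h
      obtain ⟨m, hm⟩ := hnorm x (norm_pos_iff.1 (one_pos.trans h))
      rw [hm, one_lt_zpow_iff_right₀ hq] at h
      exact ⟨(m - 1).toNat, by rw [hm]; congr 1; omega⟩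
    · rintro ⟨n, hn⟩
      rw [hn]
      exact one_lt_zpow₀ hq (by omega)
  have hm (n : ℕ) : MeasurableSet {x : F | ‖x‖ = q ^ ((n : ℤ) + 1)} :=
    measurableSet_eq_fun measurable_norm measurable_const
  rw [hunion, lintegral_iUnion hm]
  · have hterm (n : ℕ) : ∫⁻ x in {x : F | ‖x‖ = q ^ ((n : ℤ) + 1)},
        (ENNReal.ofReal (‖x‖ ^ 2))⁻¹ ∂μ = ENNReal.ofReal (q⁻¹ ^ n * (q⁻¹ * (1 - q⁻¹))) := by
      rw [setLIntegral_congr_fun (hm n)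
          (g := fun _ => ENNReal.ofReal (((q ^ ((n : ℤ) + 1)) ^ 2)⁻¹)),
        setLIntegral_const, measure_norm_eq_zpow hq hnorm hball,
        ← ENNReal.ofReal_mul (by positivity)]
      · congr 1
        rw [add_sub_cancel_right, zpow_add_one₀ hq0.ne', zpow_natCast, inv_pow]
        field_simp
      · intro x hx
        have hx : ‖x‖ = _ := hx
        simp only [hx]
        rw [ENNReal.ofReal_inv_of_pos (by positivity)]
    simp_rw [hterm]
    have hr : q⁻¹ < 1 := inv_lt_one_of_one_lt₀ hq
    rw [← ENNReal.ofReal_tsum_of_nonneg, tsum_mul_right, tsum_geometric_of_lt_one _ hr]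
    · congr 1
      rw [mul_comm q⁻¹, inv_mul_cancel_left₀ (by linarith)]
    · positivity
    · intro n
      have : 0 ≤ 1 - q⁻¹ := by linarith
      positivity
    · exact (summable_geometric_of_lt_one (by positivity) hr).mul_right _
  · intro m n hmn
    refine Set.disjoint_left.2 fun x (h1 : ‖x‖ = _) (h2 : ‖x‖ = _) => hmn ?_
    have := zpow_right_injective₀ hq0 hq.ne' (h1.symm.trans h2)
    omega

theorem setLIntegral_prod_fst {α β : Type*} [MeasurableSpace α] [MeasurableSpace β] (μ : Measure α)
    (ν : Measure β) [SFinite μ] [SFinite ν] {s : Set (α × β)} (hs : MeasurableSet s)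
    {f : α → ENNReal} (hf : Measurable f) :
    ∫⁻ p in s, f p.1 ∂μ.prod ν = ∫⁻ x, f x * ν (Prod.mk x ⁻¹' s) ∂μ := by
  rw [← lintegral_indicator hs, lintegral_prod]
  · refine lintegral_congr fun x => ?_
    rw [← lintegral_indicator_const (measurable_prodMk_left hs)]
    rfl
  · exact ((hf.comp measurable_fst).indicator hs).aemeasurable

theorem measurableSet_innerRegion : MeasurableSet (innerRegion F) :=
  (measurableSet_le (f := fun p : F × F => ‖p.1‖) (by fun_prop) measurable_const).inter
    (measurableSet_le (f := fun p : F × F => ‖p.2‖) (by fun_prop) measurable_const)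

variable [SecondCountableTopology F]

theorem measurableSet_regionFst : MeasurableSet (regionFst F) :=
  (measurableSet_lt (g := fun p : F × F => ‖p.1‖) measurable_const (by fun_prop)).inter
    (measurableSet_le (f := fun p : F × F => ‖p.1 * p.2‖) (by fun_prop) measurable_const)

theorem measurableSet_regionSnd : MeasurableSet (regionSnd F) :=
  (measurableSet_lt (g := fun p : F × F => ‖p.2‖) measurable_const (by fun_prop)).inter
    (measurableSet_le (f := fun p : F × F => ‖p.1 * p.2‖) (by fun_prop) measurable_const)

theorem measurableSet_regionDiag : MeasurableSet (regionDiag F) :=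
  (measurableSet_lt (g := fun p : F × F => ‖p.1‖) measurable_const (by fun_prop)).inter
    (measurableSet_le (f := fun p : F × F => ‖p.1 + p.2‖) (by fun_prop) measurable_const)

variable [SFinite μ]

/-- For fixed `x`, the slice is a ball of radius `‖x‖⁻¹`. -/
theorem lintegral_regionFst (hq : 1 < q) (hnorm : ∀ x : F, x ≠ 0 → ∃ n : ℤ, ‖x‖ = q ^ n)
    (hball : ∀ n : ℤ, μ {x | ‖x‖ ≤ q ^ n} = ENNReal.ofReal (q ^ n)) :
    ∫⁻ p in regionFst F, (ENNReal.ofReal ‖p.1‖)⁻¹ ∂μ.prod μ = ENNReal.ofReal q⁻¹ := by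
  have hm : MeasurableSet {x : F | 1 < ‖x‖} := measurableSet_lt measurable_const measurable_norm
  rw [setLIntegral_prod_fst μ μ measurableSet_regionFst (f := fun x => (ENNReal.ofReal ‖x‖)⁻¹)
    (by fun_prop), ← lintegral_inv_norm_sq hq hnorm hball, ← lintegral_indicator hm]
  refine lintegral_congr fun x => ?_
  by_cases hx : 1 < ‖x‖
  · have hx0 : 0 < ‖x‖ := one_pos.trans hx
    have hslice : Prod.mk x ⁻¹' regionFst F = {y | ‖y‖ ≤ ‖x‖⁻¹} := by
      ext y
      simp [regionFst, hx, hx0, ← one_div, le_div_iff₀, mul_comm]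
    rw [Set.indicator_of_mem (show x ∈ {x : F | 1 < ‖x‖} from hx), hslice,
      measure_norm_le_inv hnorm hball (norm_pos_iff.1 hx0), ENNReal.ofReal_inv_of_pos hx0,
      ENNReal.ofReal_pow hx0.le, sq, ENNReal.mul_inv (.inr (by simp)) (.inl (by simp))]
  · have hslice : Prod.mk x ⁻¹' regionFst F = ∅ := by
      ext y
      simp [regionFst, hx]
    rw [Set.indicator_of_notMem (show x ∉ {x : F | 1 < ‖x‖} from hx), hslice, measure_empty,
      mul_zero]

/-- This is `lintegral_regionFst` with the coordinates exchanged. -/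
theorem lintegral_regionSnd (hq : 1 < q) (hnorm : ∀ x : F, x ≠ 0 → ∃ n : ℤ, ‖x‖ = q ^ n)
    (hball : ∀ n : ℤ, μ {x | ‖x‖ ≤ q ^ n} = ENNReal.ofReal (q ^ n)) :
    ∫⁻ p in regionSnd F, (ENNReal.ofReal ‖p.2‖)⁻¹ ∂μ.prod μ = ENNReal.ofReal q⁻¹ := by
  rw [← lintegral_regionFst hq hnorm hball, ← Measure.prod_swap (μ := μ) (ν := μ),
    setLIntegral_map measurableSet_regionSnd (by fun_prop) measurable_swap, Measure.prod_swap]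
  have : Prod.swap ⁻¹' regionSnd F = regionFst F := by
    ext p
    simp [regionFst, regionSnd, mul_comm]
  rw [this]
  rfl

/-- For fixed `x`, the slice is a translate of the unit ball. -/
theorem lintegral_regionDiag [μ.IsAddLeftInvariant] (hq : 1 < q)
    (hnorm : ∀ x : F, x ≠ 0 → ∃ n : ℤ, ‖x‖ = q ^ n)
    (hball : ∀ n : ℤ, μ {x | ‖x‖ ≤ q ^ n} = ENNReal.ofReal (q ^ n)) :
    ∫⁻ p in regionDiag F, (ENNReal.ofReal (‖p.1‖ ^ 2))⁻¹ ∂μ.prod μ = ENNReal.ofReal q⁻¹ := by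
  have hm : MeasurableSet {x : F | 1 < ‖x‖} := measurableSet_lt measurable_const measurable_norm
  rw [setLIntegral_prod_fst μ μ measurableSet_regionDiag
    (f := fun x => (ENNReal.ofReal (‖x‖ ^ 2))⁻¹) (by fun_prop),
    ← lintegral_inv_norm_sq hq hnorm hball, ← lintegral_indicator hm]
  refine lintegral_congr fun x => ?_
  by_cases hx : 1 < ‖x‖
  · have hslice : Prod.mk x ⁻¹' regionDiag F = (fun y => x + y) ⁻¹' {y | ‖y‖ ≤ q ^ (0 : ℤ)} := by
      ext y
      simp [regionDiag, hx]
    rw [Set.indicator_of_mem (show x ∈ {x : F | 1 < ‖x‖} from hx), hslice, measure_preimage_add,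
      hball, zpow_zero, ENNReal.ofReal_one, mul_one]
  · have hslice : Prod.mk x ⁻¹' regionDiag F = ∅ := by
      ext y
      simp [regionDiag, hx]
    rw [Set.indicator_of_notMem (show x ∉ {x : F | 1 < ‖x‖} from hx), hslice, measure_empty,
      mul_zero]

/-- The bounded piece contributes `1`, and each of the `6 - #D_i` others contributes `q⁻¹`. -/
theorem lintegral_integralRegion [IsUltrametricDist F] [μ.IsAddLeftInvariant] (hq : 1 < q)
    (hnorm : ∀ x : F, x ≠ 0 → ∃ n : ℤ, ‖x‖ = q ^ n)
    (hball : ∀ n : ℤ, μ {x | ‖x‖ ≤ q ^ n} = ENNReal.ofReal (q ^ n)) (i : Boundary) :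
    ∫⁻ p in integralRegion F i, (ENNReal.ofReal (chartNorm i 0 p))⁻¹ ∂μ.prod μ =
      ENNReal.ofReal (1 + (6 - ((boundaryComponents i).card : ℝ)) / q) := by
  have hq0 : 0 < q := one_pos.trans hq
  have hinner : ∫⁻ p in innerRegion F, (ENNReal.ofReal (chartNorm i 0 p))⁻¹ ∂μ.prod μ = 1 := by
    rw [setLIntegral_congr_fun (g := fun _ => 1) measurableSet_innerRegion
      (fun p hp => by simp [chartNorm_of_mem_innerRegion i hp]), setLIntegral_const, one_mul]
    have h1 := hball 0
    simp only [zpow_zero, ENNReal.ofReal_one] at h1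
    have : innerRegion F = {x | ‖x‖ ≤ 1} ×ˢ {x | ‖x‖ ≤ 1} := rfl
    rw [this, Measure.prod_prod, h1, one_mul]
  have hfst : ∫⁻ p in regionFst F, (ENNReal.ofReal (chartNorm i 0 p))⁻¹ ∂μ.prod μ =
      ENNReal.ofReal q⁻¹ := by
    rw [← lintegral_regionFst hq hnorm hball]
    exact setLIntegral_congr_fun measurableSet_regionFst
      fun p hp => by simp only [chartNorm_of_mem_regionFst i hp]
  have hdiag : ∫⁻ p in regionDiag F, (ENNReal.ofReal (chartNorm i 0 p))⁻¹ ∂μ.prod μ =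
      ENNReal.ofReal q⁻¹ := by
    rw [← lintegral_regionDiag hq hnorm hball]
    exact setLIntegral_congr_fun measurableSet_regionDiag
      fun p hp => by simp only [chartNorm_of_mem_regionDiag i hp]
  have hr : 0 ≤ q⁻¹ := by positivity
  cases i
  · have hsnd : ∫⁻ p in regionSnd F, (ENNReal.ofReal (chartNorm .singularity 0 p))⁻¹ ∂μ.prod μ =
        ENNReal.ofReal q⁻¹ := by
      rw [← lintegral_regionSnd hq hnorm hball]
      exact setLIntegral_congr_fun measurableSet_regionSnd
        fun p hp => by simp only [chartNorm_of_mem_regionSnd hp]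
    rw [integralRegion, lintegral_union _ disjoint_innerRegion,
      lintegral_union _ disjoint_regionFst, lintegral_union _ disjoint_regionDiag, hinner, hfst,
      hdiag, hsnd, ← ENNReal.ofReal_one, ← ENNReal.ofReal_add hr hr,
      ← ENNReal.ofReal_add hr (by positivity), ← ENNReal.ofReal_add one_pos.le (by positivity)]
    · congr 1
      have : (boundaryComponents .singularity).card = 3 := rfl
      rw [this]
      push_cast
      ring
    · exact measurableSet_regionSnd
    · exact measurableSet_regionDiag.union measurableSet_regionSnd
    · exact measurableSet_regionFst.union (measurableSet_regionDiag.union measurableSet_regionSnd)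
  · rw [integralRegion, lintegral_union _ (disjoint_innerRegion.mono_right
        (Set.union_subset_union_right _ Set.subset_union_left)),
      lintegral_union _ (disjoint_regionFst.mono_right Set.subset_union_left), hinner, hfst,
      hdiag, ← ENNReal.ofReal_one, ← ENNReal.ofReal_add hr hr,
      ← ENNReal.ofReal_add one_pos.le (by positivity)]
    · congr 1
      have : (boundaryComponents .line).card = 4 := rfl
      rw [this]
      push_cast
      ring
    · exact measurableSet_regionDiag
    · exact measurableSet_regionFst.union measurableSet_regionDiag

end Integrals

/-! ### The Haar measure on `K_𝔭` -/

section Haar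

open NumberField.HeightOneSpectrum
open scoped Pointwise

variable {K : Type*} [Field K] [NumberField K] (v : HeightOneSpectrum (𝓞 K))

theorem norm_le_one_iff_mem (x : v.adicCompletion K) :
    ‖x‖ ≤ 1 ↔ x ∈ v.adicCompletionIntegers K := by
  rw [mem_adicCompletionIntegers]
  exact Valued.toNormedField.norm_le_one_iff

instance : ProperSpace (v.adicCompletion K) := by
  refine Valued.integer.properSpace_iff_compactSpace_integer.2 ?_
  exact isCompact_iff_compactSpace.1 (isCompact_adicIntegers v)

instance : (adicHaar (K := K) v).IsAddHaarMeasure := by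
  unfold adicHaar; infer_instance

instance : (adicHaar (K := K) v).Regular := by
  unfold adicHaar; infer_instance

theorem exists_norm_eq_zpow {x : v.adicCompletion K} (hx : x ≠ 0) :
    ∃ n : ℤ, ‖x‖ = (Ideal.absNorm v.asIdeal : ℝ) ^ n := by
  rw [FinitePlace.norm_def, WithZeroMulInt.toNNReal_neg_apply _ ((Valued.v.ne_zero_iff).2 hx)]
  exact ⟨_, by push_cast; rfl⟩

theorem exists_norm_eq_inv : ∃ π : v.adicCompletion K, ‖π‖ = (Ideal.absNorm v.asIdeal : ℝ)⁻¹ := by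
  obtain ⟨π, hπ⟩ := v.valuation_exists_uniformizer K
  refine ⟨(π : K), ?_⟩
  rw [FinitePlace.norm_def, valuedAdicCompletion_eq_valuation', hπ,
    WithZeroMulInt.toNNReal_neg_apply _ WithZero.exp_ne_zero]
  exact zpow_neg_one _

theorem adicHaar_norm_le_one : adicHaar v {x : v.adicCompletion K | ‖x‖ ≤ 1} = 1 := by
  have : {x : v.adicCompletion K | ‖x‖ ≤ 1} = v.adicCompletionIntegers K := by
    ext x
    exact norm_le_one_iff_mem v x
  rw [this, adicHaar]
  exact Measure.addHaarMeasure_self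

/-- Every residue class of the ring of integers of `K_𝔭` contains an element of `𝓞 K`. -/
theorem exists_norm_sub_lt_one (x : v.adicCompletion K) (hx : ‖x‖ ≤ 1) :
    ∃ r : 𝓞 K, ‖x - ((r : K) : v.adicCompletion K)‖ < 1 := by
  obtain ⟨k, hk⟩ := Metric.denseRange_iff.1
    (denseRange_algebraMap (R := 𝓞 K) K v) x 1 one_pos
  have hk : ‖x - (k : v.adicCompletion K)‖ < 1 := by
    rw [← dist_eq_norm]
    exact hk
  have hk1 : v.valuation K k ≤ 1 := by
    rw [← valuedAdicCompletion_eq_valuation' v k, ← Valued.toNormedField.norm_le_one_iff]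
    rw [norm_sub_rev] at hk
    have := IsUltrametricDist.norm_add_le_max ((k : v.adicCompletion K) - x) x
    rw [sub_add_cancel] at this
    exact this.trans (max_le hk.le hx)
  obtain ⟨r, hr⟩ := exists_valuation_sub_lt_of_integer (K := K) v hk1 1
  refine ⟨r, ?_⟩
  have hr' : ‖FinitePlace.embedding v ((r : K) - k)‖ < 1 := by
    rw [FinitePlace.embedding_apply, Valued.toNormedField.norm_lt_one_iff,
      valuedAdicCompletion_eq_valuation']
    exact hr
  rw [map_sub, norm_sub_rev] at hr'
  have := (IsUltrametricDist.norm_add_le_max _ _).trans_lt (max_lt hk hr')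
  rwa [FinitePlace.embedding_apply, FinitePlace.embedding_apply, sub_add_sub_cancel] at this

/-- The ring of integers is the disjoint union of the `N(𝔭)` cosets of its maximal ideal. -/
theorem adicHaar_norm_lt_one :
    (Ideal.absNorm v.asIdeal : ENNReal) * adicHaar v {x : v.adicCompletion K | ‖x‖ < 1} = 1 := by
  have : Finite (𝓞 K ⧸ v.asIdeal) := v.asIdeal.finiteQuotientOfFreeOfNeBot v.ne_bot
  have := Fintype.ofFinite (𝓞 K ⧸ v.asIdeal)
  let s : 𝓞 K ⧸ v.asIdeal → v.adicCompletion K := fun c => ((Quotient.out c : 𝓞 K) : K)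
  have hs (r t : 𝓞 K) : ‖((r : K) : v.adicCompletion K) - ((t : K) : v.adicCompletion K)‖ < 1 ↔
      Ideal.Quotient.mk v.asIdeal r = Ideal.Quotient.mk v.asIdeal t := by
    rw [Ideal.Quotient.eq, ← FinitePlace.norm_lt_one_iff_mem K v, map_sub, map_sub]
    rfl
  have hunion : {x : v.adicCompletion K | ‖x‖ ≤ 1} =
      ⋃ c, (fun x => -s c + x) ⁻¹' {x : v.adicCompletion K | ‖x‖ < 1} := by
    ext x
    simp only [Set.mem_iUnion, Set.mem_preimage, Set.mem_ofPred_eq]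
    constructor
    · intro hx
      obtain ⟨r, hr⟩ := exists_norm_sub_lt_one v x hx
      refine ⟨Ideal.Quotient.mk _ r, ?_⟩
      have h2 := (hs r (Quotient.out (Ideal.Quotient.mk v.asIdeal r))).2 (by simp)
      have h3 := (IsUltrametricDist.norm_add_le_max _ _).trans_lt (max_lt hr h2)
      rwa [sub_add_sub_cancel, sub_eq_neg_add] at h3
    · rintro ⟨c, hc⟩
      have h2 : ‖s c‖ ≤ 1 := FinitePlace.norm_le_one K v _
      have h3 := (IsUltrametricDist.norm_add_le_max _ _).trans (max_le h2 hc.le)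
      rwa [add_neg_cancel_left] at h3
  rw [← adicHaar_norm_le_one v, hunion, measure_iUnion, tsum_fintype]
  · simp_rw [measure_preimage_add]
    rw [Finset.sum_const, Finset.card_univ, nsmul_eq_mul, ← Nat.card_eq_fintype_card]
    rfl
  · intro c d hcd
    refine Set.disjoint_left.2 fun x (h1 : ‖_‖ < 1) (h2 : ‖_‖ < 1) => hcd ?_
    rw [← norm_neg] at h1
    have h3 := (IsUltrametricDist.norm_add_le_max _ _).trans_lt (max_lt h1 h2)
    rw [neg_add, neg_neg, add_assoc, neg_add_cancel_comm_assoc, ← sub_eq_add_neg, hs] at h3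
    simpa using h3
  · intro c
    exact (measurableSet_lt measurable_norm measurable_const).preimage (measurable_const_add _)

/-- Multiplication by a uniformizer scales the Haar measure by `N(𝔭)⁻¹`, since it maps the ring of
integers to its maximal ideal. -/
theorem adicHaar_norm_le_zpow (n : ℤ) :
    adicHaar v {x : v.adicCompletion K | ‖x‖ ≤ (Ideal.absNorm v.asIdeal : ℝ) ^ n} =
      ENNReal.ofReal ((Ideal.absNorm v.asIdeal : ℝ) ^ n) := by
  have hq : (1 : ℝ) < Ideal.absNorm v.asIdeal := by exact_mod_cast one_lt_absNorm v
  have hchar (u : (v.adicCompletion K)ˣ) : adicHaar v {x : v.adicCompletion K | ‖x‖ ≤ ‖u.1‖} =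
      distribHaarChar (v.adicCompletion K) u := by
    have : {x : v.adicCompletion K | ‖x‖ ≤ ‖u.1‖} = u • {x : v.adicCompletion K | ‖x‖ ≤ 1} := by
      ext x
      rw [Set.mem_smul_set_iff_inv_smul_mem]
      simp only [Set.mem_ofPred_eq, Units.smul_def, smul_eq_mul, Units.val_inv_eq_inv_val, norm_mul,
        norm_inv]
      rw [inv_mul_le_one₀ (by simp)]
    rw [this, ← distribHaarChar_mul, adicHaar_norm_le_one, mul_one]
  obtain ⟨π, hπ⟩ := exists_norm_eq_inv v (K := K)
  have hπ0 : π ≠ 0 := by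
    rw [← norm_ne_zero_iff, hπ]
    exact inv_ne_zero (one_pos.trans hq).ne'
  have hcharπ : distribHaarChar (v.adicCompletion K) (Units.mk0 π hπ0) =
      (Ideal.absNorm v.asIdeal : NNReal)⁻¹ := by
    refine eq_inv_of_mul_eq_one_right (ENNReal.coe_injective ?_)
    have hset : {x : v.adicCompletion K | ‖x‖ ≤ ‖π‖} = {x | ‖x‖ < 1} := by
      ext x
      simp only [Set.mem_ofPred_eq]
      rcases eq_or_ne x 0 with rfl | hx
      · simp
      · obtain ⟨m, hm⟩ := exists_norm_eq_zpow v hx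
        rw [hm, hπ, ← zpow_neg_one, zpow_le_zpow_iff_right₀ hq, zpow_lt_one_iff_right₀ hq]
        omega
    rw [ENNReal.coe_mul, ← hchar, Units.val_mk0, hset, ENNReal.coe_one, ← adicHaar_norm_lt_one v,
      ENNReal.coe_natCast]
  have := hchar (Units.mk0 π hπ0 ^ (-n))
  rw [map_zpow, hcharπ, Units.val_zpow_eq_zpow_val, Units.val_mk0, norm_zpow, hπ, inv_zpow,
    inv_zpow, zpow_neg, inv_inv, zpow_neg, inv_inv] at this
  rw [this, ENNReal.ofReal]
  congr 1
  rw [← NNReal.coe_inj, Real.coe_toNNReal _ (by positivity)]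
  push_cast
  rfl

end Haar
end QuarticDelPezzo

theorem proposition4p3 {K : Type*} [Field K] [NumberField K] [NumberField.IsTotallyComplex K]
    (hK : Module.finrank ℚ K = 2)
    (p : IsDedekindDomain.HeightOneSpectrum (NumberField.RingOfIntegers K))
    (i : QuarticDelPezzo.Boundary) :
    QuarticDelPezzo.tamagawaMeasure (QuarticDelPezzo.adicHaar p) i
        (QuarticDelPezzo.integralPoints (p.adicCompletionIntegers K) (p.adicCompletion K) i) =
      ENNReal.ofReal
        (1 + (6 - ((QuarticDelPezzo.boundaryComponents i).card : ℝ)) /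
          (Ideal.absNorm p.asIdeal : ℝ)) := by
  have hinj : Function.Injective
      (algebraMap (p.adicCompletionIntegers K) (p.adicCompletion K)) := Subtype.val_injective
  have hmem (x : p.adicCompletion K) : ‖x‖ ≤ 1 ↔
      ∃ r : p.adicCompletionIntegers K, algebraMap _ (p.adicCompletion K) r = x := by
    rw [QuarticDelPezzo.norm_le_one_iff_mem]
    exact ⟨fun h => ⟨⟨x, h⟩, rfl⟩, by rintro ⟨r, rfl⟩; exact r.2⟩
  have hunit (r : p.adicCompletionIntegers K) :
      IsUnit r ↔ ‖algebraMap _ (p.adicCompletion K) r‖ = 1 := by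
    rw [adicCompletionIntegers.isUnit_iff_valued_eq_one, le_antisymm_iff, le_antisymm_iff]
    exact and_congr Valued.toNormedField.norm_le_one_iff.symm
      Valued.toNormedField.one_le_norm_iff.symm
  have hq : (1 : ℝ) < Ideal.absNorm p.asIdeal := by
    exact_mod_cast NumberField.HeightOneSpectrum.one_lt_absNorm p
  have hnorm (x : p.adicCompletion K) := QuarticDelPezzo.exists_norm_eq_zpow p (x := x)
  have hball := QuarticDelPezzo.adicHaar_norm_le_zpow (K := K) p
  rw [QuarticDelPezzo.tamagawaMeasure_apply _ (QuarticDelPezzo.measure_singleton_zero hq hball) i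
    (QuarticDelPezzo.measurableSet_integralPoints hinj hmem hunit i),
    ← QuarticDelPezzo.lintegral_integralRegion hq hnorm hball]
  congr 2
  ext ⟨x, y⟩
  refine (QuarticDelPezzo.mk_mem_integralPoints_iff hinj hmem hunit i _).trans ?_
  change (∃ t, QuarticDelPezzo.IsIntegralLift i
    (QuarticDelPezzo.torusAct t (QuarticDelPezzo.chartCoord 0 (x, y)))) ↔ _
  rw [QuarticDelPezzo.chartCoord_zero]
  exact ⟨fun ⟨t, ht⟩ => QuarticDelPezzo.mem_integralRegion_of_lift ht,
    QuarticDelPezzo.exists_lift_of_mem_integralRegion⟩
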